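/- Let $\zeta$ be the Riemann zeta-function and set $$\xi(s)=\tfrac12\,a(s)\,\zeta(s),\qquad a(s)=(s-1)\,\pi^{-s/2}\,2\,\Gamma(1+s/2),$$ where $\xi$ is understood as an entire function (the removable singularities of the product at $s=1$ and at $s=-2,-4,\dots$ being filled in). Put $$n(s)=\sin(\pi s/4)\cdot 2\,\xi(\tfrac12+s),\qquad f(s)=\frac1{n(s)},$$ so that $n$ is entire and $f$ is meromorphic on $\mathbf{C}$. **Theorem 3.1.** Let $x$ be a real number with $x\ge 1/2$ and $x\ne 4w$ for every integer $w\ge 1$. Then $|f|$ is both integrable and square integrable on the vertical line $x+i\mathbf{R}$; that is, $$\int_{-\infty}^{\infty}|f(x+it)|\,dt<\infty\quad\text{and}\quad\int_{-\infty}^{\infty}|f(x+it)|^2\,dt<\infty .$$ -/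

import Mathlib

namespace CsizmaziaZeta

open Filter Topology

/-- `l(s) = π^(-s/2) · 2 Γ(1 + s/2)`. -/
noncomputable def l (s : ℂ) : ℂ :=
  (Real.pi : ℂ) ^ (-s / 2) * (2 * Complex.Gamma (1 + s / 2))

/-- `a(s) = l(s) (s - 1)`. -/
noncomputable def a (s : ℂ) : ℂ := l s * (s - 1)

/-- The Riemann xi function `ξ(s) = (1/2) a(s) ζ(s)`. The product on the right has removable
singularities at `1` (pole of `ζ`) and at `-2, -4, …` (poles of `Γ(1 + s/2)`, zeros of `ζ`);
taking the limit over the punctured neighbourhood gives the value of the entire function `ξ` at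
every point, also at these. -/
noncomputable def xi (s : ℂ) : ℂ :=
  limUnder (𝓝[≠] s) (fun z : ℂ => (1 / 2 : ℂ) * a z * riemannZeta z)

/-- `n(s) = sin(π s / 4) · 2 ξ(1/2 + s)`. -/
noncomputable def n (s : ℂ) : ℂ :=
  Complex.sin ((Real.pi : ℂ) * s / 4) * (2 * xi (1 / 2 + s))

/-- The meromorphic function `f(s) = 1 / n(s)`. (At its poles, the zeros of `n`, Lean gives it the
value `0`, which affects neither integrability nor the value of an integral.) -/
noncomputable def f (s : ℂ) : ℂ := 1 / n s

/-- The defining product for `ξ` agrees with the entire function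
`(s (s - 1) Λ₀(s) + 1) / 2` away from its removable singularities. -/
theorem half_a_mul_zeta_eq {s : ℂ} (h1 : s ≠ 1) (h2 : ∀ k : ℕ, s ≠ -2 * ((k : ℂ) + 1)) :
    (1 / 2 : ℂ) * a s * riemannZeta s = (s * (s - 1) * completedRiemannZeta₀ s + 1) / 2 := by
  by_cases h0 : s = 0
  · subst h0
    simp [a, l, riemannZeta_zero]
    norm_num
  · have hG : Complex.Gammaℝ s ≠ 0 := by
      rw [Ne, Complex.Gammaℝ_eq_zero_iff]
      rintro ⟨k, hk⟩
      rcases k with _ | k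
      · simp at hk; exact h0 hk
      · apply h2 k; rw [hk]; push_cast; ring
    have hs2 : s / 2 ≠ 0 := div_ne_zero h0 two_ne_zero
    have hl : l s = s * Complex.Gammaℝ s := by
      rw [l, Complex.Gammaℝ_def, add_comm 1 (s / 2), Complex.Gamma_add_one _ hs2]
      ring
    have h1' : (1 : ℂ) - s ≠ 0 := sub_ne_zero.mpr (Ne.symm h1)
    rw [a, hl, riemannZeta_def_of_ne_zero h0, completedRiemannZeta_eq]
    field_simp
    ring

theorem tendsto_half_a_mul_zeta (s : ℂ) :
    Tendsto (fun z : ℂ => (1 / 2 : ℂ) * a z * riemannZeta z) (𝓝[≠] s)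
      (𝓝 ((s * (s - 1) * completedRiemannZeta₀ s + 1) / 2)) := by
  have hcont : Continuous (fun z : ℂ => (z * (z - 1) * completedRiemannZeta₀ z + 1) / 2) := by
    have := differentiable_completedZeta₀.continuous
    fun_prop
  refine ((hcont.tendsto s).mono_left nhdsWithin_le_nhds).congr' ?_
  have hA : AnalyticOnNhd ℂ (fun z : ℂ => (Complex.Gammaℝ z)⁻¹) Set.univ :=
    Complex.differentiable_Gammaℝ_inv.differentiableOn.analyticOnNhd isOpen_univ
  have hne : ∀ᶠ z in 𝓝[≠] s, (Complex.Gammaℝ z)⁻¹ ≠ 0 := by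
    rcases (hA s (Set.mem_univ s)).eventually_eq_zero_or_eventually_ne_zero with h | h
    · have h0 := hA.eqOn_zero_of_preconnected_of_eventuallyEq_zero
        isPreconnected_univ (Set.mem_univ s) h
      have := h0 (Set.mem_univ (1 : ℂ))
      simp at this
    · exact h
  have h1 : ∀ᶠ z in 𝓝[≠] s, z ≠ 1 := by
    by_cases hs : s = 1
    · subst hs; exact eventually_mem_nhdsWithin
    · exact eventually_nhdsWithin_of_eventually_nhds (eventually_ne_nhds hs)
  filter_upwards [hne, h1] with z hz hz1
  refine (half_a_mul_zeta_eq hz1 fun k hk => hz ?_).symm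
  rw [inv_eq_zero, Complex.Gammaℝ_eq_zero_iff]
  exact ⟨k + 1, by rw [hk]; push_cast; ring⟩

theorem xi_eq (s : ℂ) : xi s = (s * (s - 1) * completedRiemannZeta₀ s + 1) / 2 :=
  (tendsto_half_a_mul_zeta s).limUnder_eq

/-- Away from the removable singularities, `ξ` is given by the defining formula. -/
theorem xi_eq_half_a_mul_zeta {s : ℂ} (h1 : s ≠ 1) (h2 : ∀ k : ℕ, s ≠ -2 * ((k : ℂ) + 1)) :
    xi s = (1 / 2 : ℂ) * a s * riemannZeta s := by
  rw [xi_eq, half_a_mul_zeta_eq h1 h2]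

theorem xi_differentiable : Differentiable ℂ xi := by
  have h : xi = fun s : ℂ => (s * (s - 1) * completedRiemannZeta₀ s + 1) / 2 := funext xi_eq
  rw [h]
  have := differentiable_completedZeta₀
  fun_prop

end CsizmaziaZeta

namespace CsizmaziaZeta

open Filter Topology

/-! On the line `Re s = x` the denominator is `n(s) = sin(πs/4) · l(1/2+s) · (s-1/2) · ζ(1/2+s)`. It
has no zero there: `Re(1/2+s) ≥ 1` excludes zeros of `ξ`, and the zeros of the sine are multiples of
`4`. So `|f|` is continuous on the line and only its decay matters.

For large `|t|` the sine is at least a constant times `e^{π|t|/4}`, while `l(1/2+s)` contains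
`Γ(1+(1/2+s)/2)`, of size at least a constant times `|t| e^{-π|t|/4}`. The exponentials cancel. With
the factor `s-1/2` this leaves `|t|²|ζ(1/2+s)|`, so any bound `|ζ| ≥ c|t|^{-θ}` with `θ < 1` is
enough. Here `θ = 1/5`, giving `f = O(|t|^{-9/5})` (`exists_le_norm_n`). This is integrable and
bounded, hence square integrable.

The Gamma bound (`le_norm_Gamma`) avoids Stirling: Phragmén–Lindelöf gives an upper bound in a
strip, reflection turns it into a lower bound, and the recurrence moves it to the right. The zeta
bound is delicate only at `x = 1/2`, on the line `Re = 1`. There the 3-4-1 inequality bounds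
`ζ(1+d+it)` below for `d = |t|^{-1/4}`, and approximation of `ζ` by partial sums shows that moving
from `1+d+it` to `1+it` costs less. -/

/-! ### Lower bounds for the Gamma function on vertical lines -/

theorem norm_Gamma_le_Gamma_re {s : ℂ} (hs : 0 < s.re) : ‖Complex.Gamma s‖ ≤ Real.Gamma s.re := by
  rw [Complex.Gamma_eq_integral hs, Complex.GammaIntegral, Real.Gamma_eq_integral hs]
  refine (MeasureTheory.norm_integral_le_integral_norm _).trans_eq ?_
  refine MeasureTheory.setIntegral_congr_fun measurableSet_Ioi fun x hx => ?_
  rw [norm_mul, Complex.norm_cpow_eq_rpow_re_of_pos hx, Complex.norm_real,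
    Real.norm_of_nonneg (Real.exp_pos _).le]
  simp

theorem norm_cos_ge (z : ℂ) : Real.exp |z.im| - 1 ≤ 2 * ‖Complex.cos z‖ := by
  have h1 : 2 * Complex.cos z = Complex.exp (z * Complex.I) + Complex.exp (-z * Complex.I) := by
    rw [Complex.cos]; ring
  have n1 : ‖Complex.exp (z * Complex.I)‖ = Real.exp (-z.im) := by
    rw [Complex.norm_exp]; simp
  have n2 : ‖Complex.exp (-z * Complex.I)‖ = Real.exp z.im := by
    rw [Complex.norm_exp]; simp
  have h3 : 2 * ‖Complex.cos z‖ = ‖Complex.exp (z * Complex.I) + Complex.exp (-z * Complex.I)‖ := by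
    rw [← h1]; simp
  rw [h3]
  rcases le_total 0 z.im with h | h
  · have := norm_sub_le_norm_add (Complex.exp (-z * Complex.I)) (Complex.exp (z * Complex.I))
    rw [add_comm, n1, n2] at this
    have h4 : Real.exp (-z.im) ≤ 1 := Real.exp_le_one_iff.2 (by linarith)
    rw [abs_of_nonneg h]; linarith
  · have := norm_sub_le_norm_add (Complex.exp (z * Complex.I)) (Complex.exp (-z * Complex.I))
    rw [n1, n2] at this
    have h4 : Real.exp (z.im) ≤ 1 := Real.exp_le_one_iff.2 h
    rw [abs_of_nonpos h]; linarith

theorem norm_sin_ge (z : ℂ) : Real.exp |z.im| - 1 ≤ 2 * ‖Complex.sin z‖ := by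
  have := norm_cos_ge (z - Real.pi / 2)
  rw [Complex.cos_sub_pi_div_two] at this
  simpa [Complex.div_im] using this

theorem norm_sin_le_exp_abs_im (z : ℂ) : ‖Complex.sin z‖ ≤ Real.exp |z.im| := by
  have h1 : 2 * Complex.sin z =
      (Complex.exp (-z * Complex.I) - Complex.exp (z * Complex.I)) * Complex.I := by
    rw [Complex.sin]; ring
  have h3 : 2 * ‖Complex.sin z‖ =
      ‖Complex.exp (-z * Complex.I) - Complex.exp (z * Complex.I)‖ := by
    have := congrArg norm h1
    simpa using this
  have n1 : ‖Complex.exp (z * Complex.I)‖ ≤ Real.exp |z.im| := by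
    rw [Complex.norm_exp]; simpa using neg_le_abs _
  have n2 : ‖Complex.exp (-z * Complex.I)‖ ≤ Real.exp |z.im| := by
    rw [Complex.norm_exp]; simpa using le_abs_self _
  have := norm_sub_le (Complex.exp (-z * Complex.I)) (Complex.exp (z * Complex.I))
  linarith

/-- On the critical line `1 - s` is the conjugate of `s`, so the reflection formula computes the
modulus exactly. -/
theorem norm_Gamma_half_add_mul_I_sq (y : ℝ) :
    ‖Complex.Gamma (1 / 2 + y * Complex.I)‖ ^ 2 = Real.pi / Real.cosh (Real.pi * y) := by
  have h := Complex.Gamma_mul_Gamma_one_sub (1 / 2 + y * Complex.I)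
  have h1 : (1 : ℂ) - (1 / 2 + y * Complex.I) = (starRingEnd ℂ) (1 / 2 + y * Complex.I) := by
    simp only [map_add, map_div₀, map_one, map_mul, Complex.conj_ofReal, Complex.conj_I,
      Complex.conj_ofNat]
    ring
  rw [h1, Complex.Gamma_conj, Complex.mul_conj, Complex.normSq_eq_norm_sq] at h
  have h2 : Complex.sin (Real.pi * (1 / 2 + y * Complex.I)) = (Real.cosh (Real.pi * y) : ℝ) := by
    rw [show (Real.pi : ℂ) * (1 / 2 + y * Complex.I) = (Real.pi * y : ℂ) * Complex.I + Real.pi / 2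
      by ring, Complex.sin_add_pi_div_two, Complex.cos_mul_I]
    push_cast; rfl
  rw [h2] at h
  exact_mod_cast h

theorem norm_Gamma_half_add_mul_I_le (y : ℝ) :
    ‖Complex.Gamma (1 / 2 + y * Complex.I)‖ * Real.exp (Real.pi / 2 * y) ≤ 3 := by
  refine abs_le_of_sq_le_sq' (a := _) (b := (3 : ℝ)) ?_ (by norm_num) |>.2
  have hc : Real.exp (Real.pi * y) ≤ 2 * Real.cosh (Real.pi * y) := by
    rw [Real.cosh_eq]; have := Real.exp_pos (-(Real.pi * y)); linarith
  have hp := Real.cosh_pos (Real.pi * y)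
  rw [mul_pow, norm_Gamma_half_add_mul_I_sq, ← Real.exp_nat_mul,
    show ((2 : ℕ) : ℝ) * (Real.pi / 2 * y) = Real.pi * y by push_cast; ring, div_mul_eq_mul_div,
    div_le_iff₀ hp]
  nlinarith [Real.pi_lt_four, Real.pi_pos]

/-- Phragmén–Lindelöf in the strip. The weight must be holomorphic, so it is `exp(-iπz/2)`, sharp
only in the upper half-plane. Dividing by `z + 1` absorbs the factor `z - 1` that the recurrence
produces on the right edge. -/
theorem norm_Gamma_mul_exp_le {s : ℂ} (h1 : 1 / 2 ≤ s.re) (h2 : s.re ≤ 3 / 2) :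
    ‖Complex.Gamma s‖ * Real.exp (Real.pi / 2 * s.im) ≤ 3 * ‖s + 1‖ := by
  have hn (z : ℂ) : ‖Complex.exp (-(Real.pi / 2 * z * Complex.I))‖ =
      Real.exp (Real.pi / 2 * z.im) := by
    rw [Complex.norm_exp]
    congr 1
    simp
  have h1z (z : ℂ) (hz : 0 ≤ z.re) : 1 ≤ ‖z + 1‖ := by
    have := Complex.re_le_norm (z + 1)
    simp at this; linarith
  set g : ℂ → ℂ := fun z => Complex.Gamma z * Complex.exp (-(Real.pi / 2 * z * Complex.I)) / (z + 1)
    with hg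
  have hgn (z : ℂ) :
      ‖g z‖ = ‖Complex.Gamma z‖ * Real.exp (Real.pi / 2 * z.im) / ‖z + 1‖ := by
    rw [hg]; simp only [norm_div, norm_mul, hn]
  have key : ‖g s‖ ≤ 3 := by
    refine PhragmenLindelof.vertical_strip (a := 1 / 2) (b := 3 / 2) ?_ ?_ ?_ ?_ h1 h2
    · refine DifferentiableOn.diffContOnCl fun z hz => DifferentiableAt.differentiableWithinAt ?_
      have hz' : 1 / 2 ≤ z.re := by
        have : closure (Complex.re ⁻¹' Set.Ioo (1 / 2) (3 / 2)) ⊆ {z : ℂ | 1 / 2 ≤ z.re} :=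
          closure_minimal (fun w hw => hw.1.le) (isClosed_le continuous_const Complex.continuous_re)
        exact this hz
      have hG : DifferentiableAt ℂ Complex.Gamma z := by
        refine Complex.differentiableAt_Gamma z fun m hm => ?_
        have := congrArg Complex.re hm
        simp at this
        have : (0 : ℝ) ≤ m := m.cast_nonneg
        linarith
      have hz1 : z + 1 ≠ 0 := by
        have := h1z z (by linarith)
        exact norm_pos_iff.1 (by linarith)
      exact (hG.mul (by fun_prop)).div (by fun_prop) hz1
    · obtain ⟨M, hM⟩ := (isCompact_Icc (a := (1 / 2 : ℝ)) (b := 3 / 2)).bddAbove_image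
        (f := Real.Gamma) fun r hr => (Real.differentiableAt_Gamma fun m hm => by
          have : (0 : ℝ) ≤ m := m.cast_nonneg
          linarith [hr.1]).continuousAt.continuousWithinAt
      -- The admissible growth is `exp(B exp(c|Im z|))` with `c < π`, as the strip has width `1`.
      refine ⟨1, ?_, Real.pi / 2, ?_⟩
      · norm_num; linarith [Real.pi_gt_three]
      · refine Asymptotics.IsBigO.of_bound M ?_
        refine Filter.Eventually.filter_mono inf_le_right ?_
        refine eventually_principal.2 fun z hz => ?_
        have hM1 : ‖Complex.Gamma z‖ ≤ M :=
          (norm_Gamma_le_Gamma_re (by linarith [hz.1])).trans (hM ⟨z.re, ⟨hz.1.le, hz.2.le⟩, rfl⟩)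
        rw [hgn, Real.norm_of_nonneg (Real.exp_pos _).le]
        refine (div_le_self (by positivity) (h1z z (by linarith [hz.1]))).trans ?_
        refine mul_le_mul hM1 (Real.exp_le_exp.2 ?_) (Real.exp_pos _).le
          ((norm_nonneg _).trans hM1)
        have h3 := Real.add_one_le_exp (1 * |z.im|)
        have h4 := le_abs_self z.im
        have := Real.pi_pos
        gcongr
        linarith
    · intro z hz
      have hz' : z = 1 / 2 + z.im * Complex.I := by
        apply Complex.ext <;> simp [hz]
      rw [hgn]
      refine (div_le_self (by positivity) (h1z z (by linarith))).trans ?_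
      have := norm_Gamma_half_add_mul_I_le z.im
      rwa [← hz'] at this
    · intro z hz
      have hz' : z = 1 / 2 + z.im * Complex.I + 1 := by
        apply Complex.ext <;> simp [hz]; norm_num
      have hw0 : (1 / 2 + z.im * Complex.I : ℂ) ≠ 0 := fun h => by
        have := congrArg Complex.re h
        simp at this
      have hle : ‖(1 / 2 + z.im * Complex.I : ℂ)‖ ≤ ‖z + 1‖ := by
        rw [Complex.norm_def, Complex.norm_def]
        refine Real.sqrt_le_sqrt ?_
        simp [Complex.normSq_apply, hz]
        norm_num
      rw [hgn]
      have hG : Complex.Gamma z =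
          (1 / 2 + z.im * Complex.I) * Complex.Gamma (1 / 2 + z.im * Complex.I) := by
        conv_lhs => rw [hz']
        exact Complex.Gamma_add_one _ hw0
      rw [div_le_iff₀ (by linarith [h1z z (by linarith)]), hG, norm_mul, mul_assoc, mul_comm]
      exact mul_le_mul (norm_Gamma_half_add_mul_I_le z.im) hle (norm_nonneg _) (by norm_num)
  rw [hgn, div_le_iff₀ (by linarith [h1z s (by linarith)])] at key
  exact key

/-- By reflection `|Γ(s)| = π / (|Γ(1-s)| |sin πs|)`, so upper bounds on both factors below suffice.
-/
theorem le_norm_Gamma_of_pos_im {s : ℂ} (h1 : -1 / 2 ≤ s.re) (h2 : s.re ≤ 1 / 2) (hy : 1 ≤ s.im) :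
    1 / 4 * Real.exp (-(Real.pi / 2 * s.im)) ≤ ‖Complex.Gamma s‖ * s.im := by
  have hr := Complex.Gamma_mul_Gamma_one_sub s
  -- Conjugation returns `1 - s` to the upper half-plane, where the weight is sharp.
  have hu := norm_Gamma_mul_exp_le (s := (starRingEnd ℂ) (1 - s)) (by simp; linarith)
    (by simp; linarith)
  rw [Complex.Gamma_conj, Complex.norm_conj] at hu
  have hb : ‖(starRingEnd ℂ) (1 - s) + 1‖ ≤ 4 * s.im := by
    refine (Complex.norm_le_abs_re_add_abs_im _).trans ?_
    simp
    rw [abs_of_nonneg (by linarith), abs_of_nonneg (by linarith)]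
    linarith
  have him : ((starRingEnd ℂ) (1 - s)).im = s.im := by simp
  rw [him] at hu
  have hsin : Complex.sin (Real.pi * s) ≠ 0 := by
    intro h0
    have := norm_sin_ge (Real.pi * s)
    rw [h0] at this
    simp at this
    have h3 : 0 < |Real.pi| * |s.im| := mul_pos (abs_pos.2 Real.pi_ne_zero) (abs_pos.2 (by linarith))
    linarith
  have hN : ‖Complex.Gamma s‖ * ‖Complex.Gamma (1 - s)‖ * ‖Complex.sin (Real.pi * s)‖ = Real.pi := by
    rw [← norm_mul, ← norm_mul, hr, div_mul_cancel₀ _ hsin]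
    simp [abs_of_pos Real.pi_pos]
  have hs := norm_sin_le_exp_abs_im (Real.pi * s)
  have him2 : |((Real.pi : ℂ) * s).im| = Real.pi * s.im := by
    simp [abs_mul, abs_of_pos Real.pi_pos, abs_of_nonneg (by linarith : 0 ≤ s.im)]
  rw [him2] at hs
  set E := Real.exp (Real.pi / 2 * s.im) with hE
  have hE0 : 0 < E := Real.exp_pos _
  have hEE : Real.exp (Real.pi * s.im) = E * E := by rw [hE, ← Real.exp_add]; congr 1; ring
  rw [Real.exp_neg, ← hE]
  rw [hEE] at hs
  have h5 : Real.pi ≤ ‖Complex.Gamma s‖ * (‖Complex.Gamma (1 - s)‖ * E) * E := by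
    calc Real.pi = _ := hN.symm
      _ ≤ ‖Complex.Gamma s‖ * ‖Complex.Gamma (1 - s)‖ * (E * E) := by gcongr
      _ = _ := by ring
  have h6 : Real.pi ≤ ‖Complex.Gamma s‖ * (12 * s.im) * E := by
    refine h5.trans (mul_le_mul_of_nonneg_right (mul_le_mul_of_nonneg_left ?_ (norm_nonneg _)) hE0.le)
    linarith
  rw [← div_eq_mul_inv, div_le_iff₀ hE0]
  nlinarith [Real.pi_gt_three]

/-- Each step of `Γ(z) = (z-1)Γ(z-1)` gains a factor at least `Im z`. Two steps leave the reflection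
strip: one gain cancels the loss there, the other is kept. Further gains are only used as being at
least `1`. -/
theorem le_norm_Gamma_of_re_ge_of_pos_im (k : ℕ) {s : ℂ} (h1 : 3 / 2 + k ≤ s.re)
    (h2 : s.re ≤ 5 / 2 + k) (hy : 1 ≤ s.im) :
    1 / 4 * s.im * Real.exp (-(Real.pi / 2 * s.im)) ≤ ‖Complex.Gamma s‖ := by
  have step (z : ℂ) (hz : 1 ≤ z.im) : ‖Complex.Gamma z‖ = ‖z - 1‖ * ‖Complex.Gamma (z - 1)‖ ∧
      z.im ≤ ‖z - 1‖ := by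
    have him : (z - 1).im = z.im := by simp
    have h0 : z - 1 ≠ 0 := fun h => by rw [h] at him; simp at him; linarith
    constructor
    · rw [← norm_mul, ← Complex.Gamma_add_one _ h0, sub_add_cancel]
    · rw [← him]; exact (le_abs_self _).trans (Complex.abs_im_le_norm _)
  induction k generalizing s with
  | zero =>
    obtain ⟨e1, b1⟩ := step s hy
    have hy' : 1 ≤ (s - 1).im := by simpa using hy
    obtain ⟨e2, b2⟩ := step (s - 1) hy'
    have hb := le_norm_Gamma_of_pos_im (s := s - 1 - 1) (by simp at h1 ⊢; linarith)
      (by simp at h2 ⊢; linarith) (by simpa using hy)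
    have i2 : (s - 1 - 1).im = s.im := by simp
    have i1 : (s - 1).im = s.im := by simp
    rw [i2] at hb
    rw [i1] at b2
    rw [e1, e2]
    have h0 : 0 ≤ s.im := by linarith
    calc _ = s.im * (1 / 4 * Real.exp (-(Real.pi / 2 * s.im))) := by ring
      _ ≤ s.im * (‖Complex.Gamma (s - 1 - 1)‖ * s.im) := by gcongr
      _ = s.im * (s.im * ‖Complex.Gamma (s - 1 - 1)‖) := by ring
      _ ≤ _ := by gcongr
  | succ k ih =>
    obtain ⟨e1, b1⟩ := step s hy
    push_cast at h1 h2
    have := ih (s := s - 1) (by simp; linarith) (by simp; linarith) (by simpa using hy)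
    have i1 : (s - 1).im = s.im := by simp
    rw [i1] at this
    rw [e1]
    exact this.trans (le_mul_of_one_le_left (norm_nonneg _) (by linarith))

theorem le_norm_Gamma {s : ℂ} (h1 : 3 / 2 ≤ s.re) (hy : 1 ≤ |s.im|) :
    1 / 4 * |s.im| * Real.exp (-(Real.pi / 2 * |s.im|)) ≤ ‖Complex.Gamma s‖ := by
  have pos (z : ℂ) (h1 : 3 / 2 ≤ z.re) (hy : 1 ≤ z.im) :
      1 / 4 * z.im * Real.exp (-(Real.pi / 2 * z.im)) ≤ ‖Complex.Gamma z‖ := by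
    have hf := Nat.floor_le (a := z.re - 3 / 2) (by linarith)
    have hf2 := Nat.lt_floor_add_one (z.re - 3 / 2)
    exact le_norm_Gamma_of_re_ge_of_pos_im ⌊z.re - 3 / 2⌋₊ (by linarith) (by linarith) hy
  rcases le_total 0 s.im with h | h
  · rw [abs_of_nonneg h] at hy ⊢
    exact pos s h1 hy
  · rw [abs_of_nonpos h] at hy ⊢
    have := pos ((starRingEnd ℂ) s) (by simpa using h1) (by simpa using hy)
    rwa [Complex.Gamma_conj, Complex.norm_conj, Complex.conj_im] at this

/-! ### Approximation of zeta by partial sums up to the line `Re s = 1` -/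

theorem norm_cpow_neg_le_inv {s : ℂ} (hs : 1 ≤ s.re) {x : ℝ} (hx : 1 ≤ x) :
    ‖(x : ℂ) ^ (-s)‖ ≤ x⁻¹ := by
  rw [Complex.norm_cpow_eq_rpow_re_of_pos (by linarith), ← Real.rpow_neg_one]
  exact Real.rpow_le_rpow_of_exponent_le hx (by simpa using hs)

theorem norm_cpow_neg_sub_le {s : ℂ} (hs : 1 ≤ s.re) {m : ℝ} (hm : 1 ≤ m) {u : ℝ}
    (hu : u ∈ Set.Icc m (m + 1)) :
    ‖(u : ℂ) ^ (-s) - ((m + 1 : ℝ) : ℂ) ^ (-s)‖ ≤ ‖s‖ / m ^ 2 := by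
  have hs0 : s ≠ 0 := fun h => by rw [h] at hs; norm_num at hs
  have hd : ∀ x ∈ Set.Icc m (m + 1), HasDerivWithinAt (fun y : ℝ => (y : ℂ) ^ (-s))
      (-s * (x : ℂ) ^ (-s - 1)) (Set.Icc m (m + 1)) x := fun x hx =>
    (hasDerivAt_ofReal_cpow_const (by linarith [hx.1]) (neg_ne_zero.2 hs0)).hasDerivWithinAt
  have hb : ∀ x ∈ Set.Icc m (m + 1), ‖-s * (x : ℂ) ^ (-s - 1)‖ ≤ ‖s‖ / m ^ 2 := fun x hx => by
    rw [norm_mul, norm_neg, div_eq_mul_inv,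
      Complex.norm_cpow_eq_rpow_re_of_pos (by linarith [hx.1])]
    gcongr
    have h2 : (-s - 1).re ≤ -2 := by simp; linarith
    calc x ^ (-s - 1).re ≤ x ^ (-2 : ℝ) :=
          Real.rpow_le_rpow_of_exponent_le (by linarith [hx.1]) h2
      _ ≤ m ^ (-2 : ℝ) := Real.rpow_le_rpow_of_nonpos (by linarith) hx.1 (by norm_num)
      _ = (m ^ 2)⁻¹ := by rw [Real.rpow_neg (by linarith)]; norm_num
  have := (convex_Icc m (m + 1)).norm_image_sub_le_of_norm_hasDerivWithin_le hd hb
    (Set.right_mem_Icc.2 (by linarith)) hu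
  refine this.trans (mul_le_of_le_one_right (by positivity) ?_)
  rw [Real.norm_eq_abs, abs_le]
  constructor <;> linarith [hu.1, hu.2]

theorem norm_cpow_neg_sub_primitive_le {s : ℂ} (hs : 1 ≤ s.re) (hs1 : s ≠ 1) {m : ℝ} (hm : 1 ≤ m) :
    ‖((m + 1 : ℝ) : ℂ) ^ (-s) -
      (((m + 1 : ℝ) : ℂ) ^ (-s + 1) / (-s + 1) - (m : ℂ) ^ (-s + 1) / (-s + 1))‖
        ≤ ‖s‖ / m ^ 2 := by
  set c := ((m + 1 : ℝ) : ℂ) ^ (-s) with hc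
  -- Subtracting the linear function `y * c` makes the derivative `y^{-s} - c`, which the previous
  -- lemma bounds.
  have hd : ∀ x ∈ Set.Icc m (m + 1),
      HasDerivWithinAt (fun y : ℝ => (y : ℂ) ^ (-s + 1) / (-s + 1) - (y : ℂ) * c)
      ((x : ℂ) ^ (-s) - 1 * c) (Set.Icc m (m + 1)) x := fun x hx => by
    refine HasDerivAt.hasDerivWithinAt (HasDerivAt.sub ?_ ?_)
    · exact hasDerivAt_ofReal_cpow_const' (by linarith [hx.1]) fun h => hs1 (neg_injective h)
    · exact (Complex.ofRealCLM.hasDerivAt (x := x)).mul_const c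
  have hb : ∀ x ∈ Set.Icc m (m + 1), ‖(x : ℂ) ^ (-s) - 1 * c‖ ≤ ‖s‖ / m ^ 2 := fun x hx => by
    rw [one_mul]; exact norm_cpow_neg_sub_le hs hm hx
  have := (convex_Icc m (m + 1)).norm_image_sub_le_of_norm_hasDerivWithin_le hd hb
    (Set.right_mem_Icc.2 (by linarith)) (Set.left_mem_Icc.2 (by linarith))
  simp only [sub_add_cancel_left, norm_neg, norm_one, mul_one] at this
  convert! this using 2
  push_cast
  ring

theorem norm_sum_Ico_cpow_sub_le {s : ℂ} (hs : 1 ≤ s.re) (hs1 : s ≠ 1) {N M : ℕ} (hN : 1 ≤ N)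
    (hM : N ≤ M) :
    ‖∑ m ∈ Finset.Ico N M, ((m + 1 : ℝ) : ℂ) ^ (-s) -
      (((M : ℝ) : ℂ) ^ (-s + 1) / (-s + 1) - ((N : ℝ) : ℂ) ^ (-s + 1) / (-s + 1))‖
        ≤ 2 * ‖s‖ * (1 / N - 1 / M) := by
  induction M, hM using Nat.le_induction with
  | base => simp
  | succ M hM ih =>
    have hM1 : (1 : ℝ) ≤ M := by exact_mod_cast hN.trans hM
    have h := norm_cpow_neg_sub_primitive_le hs hs1 hM1
    rw [Finset.sum_Ico_succ_top hM]
    -- `1/M² ≤ 2/(M(M+1))` makes the error telescope.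
    have h2 : ‖s‖ / (M : ℝ) ^ 2 ≤ 2 * ‖s‖ * (1 / M - 1 / (M + 1)) := by
      have : (1 : ℝ) / M - 1 / (M + 1) = 1 / (M * (M + 1)) := by field_simp; ring
      rw [this, div_eq_mul_inv, mul_comm (2 : ℝ), mul_assoc]
      gcongr
      rw [mul_one_div, inv_eq_one_div, div_le_div_iff₀ (by positivity) (by positivity)]
      nlinarith
    push_cast at ih h ⊢
    refine le_trans ?_ ((add_le_add ih (h.trans h2)).trans_eq (by ring))
    refine le_trans (le_of_eq ?_) (norm_add_le _ _)
    congr 1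
    ring

theorem norm_riemannZeta_sub_sum_le_of_one_lt {s : ℂ} (hs : 1 < s.re) {N : ℕ} (hN : 1 ≤ N) :
    ‖riemannZeta s - ∑ m ∈ Finset.range N, ((m + 1 : ℝ) : ℂ) ^ (-s)‖
      ≤ 2 / ‖s - 1‖ + 2 * ‖s‖ / N := by
  have hs1 : s ≠ 1 := fun h => by rw [h] at hs; norm_num at hs
  have hsum : HasSum (fun m : ℕ => ((m + 1 : ℝ) : ℂ) ^ (-s)) (riemannZeta s) := by
    have h1 : Summable fun m : ℕ => 1 / ((m : ℂ) + 1) ^ s := by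
      have := (summable_nat_add_iff 1).2 (Complex.summable_one_div_nat_cpow.2 hs)
      simpa using this
    have := h1.hasSum
    rw [← zeta_eq_tsum_one_div_nat_add_one_cpow hs] at this
    refine this.congr_fun ?_
    intro m
    rw [Complex.cpow_neg, one_div]
    push_cast
    rfl
  have ht := (hsum.tendsto_sum_nat.sub_const (∑ m ∈ Finset.range N, ((m + 1 : ℝ) : ℂ) ^ (-s))).norm
  refine le_of_tendsto ht ?_
  filter_upwards [eventually_ge_atTop N] with M hM
  rw [← Finset.sum_Ico_eq_sub _ hM]
  have h := norm_sum_Ico_cpow_sub_le hs.le hs1 hN hM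
  have hF (K : ℕ) (hK : 1 ≤ K) : ‖((K : ℝ) : ℂ) ^ (-s + 1) / (-s + 1)‖ ≤ 1 / ‖s - 1‖ := by
    have hK1 : (1 : ℝ) ≤ K := by exact_mod_cast hK
    rw [norm_div, Complex.norm_cpow_eq_rpow_re_of_pos (by linarith),
      show -s + 1 = -(s - 1) by ring, norm_neg]
    gcongr
    exact Real.rpow_le_one_of_one_le_of_nonpos hK1 (by simp; linarith)
  have h1 := hF N hN
  have h2 := hF M (hN.trans hM)
  have h3 := norm_sub_le (((M : ℝ) : ℂ) ^ (-s + 1) / (-s + 1)) (((N : ℝ) : ℂ) ^ (-s + 1) / (-s + 1))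
  have h4 := norm_le_norm_add_norm_sub
    (((M : ℝ) : ℂ) ^ (-s + 1) / (-s + 1) - ((N : ℝ) : ℂ) ^ (-s + 1) / (-s + 1))
    (∑ m ∈ Finset.Ico N M, ((m + 1 : ℝ) : ℂ) ^ (-s))
  have h5 : 2 * ‖s‖ * (1 / N - 1 / M : ℝ) ≤ 2 * ‖s‖ / N := by
    rw [div_eq_mul_one_div (2 * ‖s‖)]
    gcongr
    have : (0 : ℝ) ≤ 1 / M := by positivity
    linarith
  have h6 : 2 / ‖s - 1‖ = 1 / ‖s - 1‖ + 1 / ‖s - 1‖ := by ring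
  rw [norm_sub_rev (_ - _) (∑ m ∈ Finset.Ico N M, _)] at h4
  linarith

/-- The bound is uniform as `Re s → 1` away from the pole, so it passes to the boundary by
continuity along `s + e`, `e → 0+`. -/
theorem norm_riemannZeta_sub_sum_le {s : ℂ} (hs : 1 ≤ s.re) (hs1 : s ≠ 1) {N : ℕ} (hN : 1 ≤ N) :
    ‖riemannZeta s - ∑ m ∈ Finset.range N, ((m + 1 : ℝ) : ℂ) ^ (-s)‖
      ≤ 2 / ‖s - 1‖ + 2 * ‖s‖ / N := by
  have hc : Tendsto (fun e : ℝ => s + e) (𝓝[>] 0) (𝓝 s) := by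
    have : Continuous fun e : ℝ => s + e := by fun_prop
    simpa using (this.tendsto 0).mono_left nhdsWithin_le_nhds
  have h1 : ContinuousAt (fun z : ℂ => ‖riemannZeta z -
      ∑ m ∈ Finset.range N, ((m + 1 : ℝ) : ℂ) ^ (-z)‖) s := by
    refine ContinuousAt.norm (ContinuousAt.sub (differentiableAt_riemannZeta hs1).continuousAt ?_)
    refine tendsto_finsetSum _ fun m _ => ?_
    have hm : ((m + 1 : ℝ) : ℂ) ≠ 0 := by exact_mod_cast m.succ_ne_zero
    exact ((continuousAt_const_cpow hm).comp continuousAt_neg)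
  have h2 : ContinuousAt (fun z : ℂ => 2 / ‖z - 1‖ + 2 * ‖z‖ / N) s := by
    have : ‖s - 1‖ ≠ 0 := norm_ne_zero_iff.2 (sub_ne_zero.2 hs1)
    have hsub : ContinuousAt (fun z : ℂ => ‖z - 1‖) s := by fun_prop
    exact (continuousAt_const.div hsub this).add (by fun_prop)
  refine le_of_tendsto_of_tendsto (h1.tendsto.comp hc) (h2.tendsto.comp hc) ?_
  filter_upwards [self_mem_nhdsWithin] with e he
  have he : 0 < e := he
  exact norm_riemannZeta_sub_sum_le_of_one_lt (by simp; linarith) hN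

theorem sum_range_inv_le_one_add_log (N : ℕ) :
    ∑ m ∈ Finset.range N, ((m : ℝ) + 1)⁻¹ ≤ 1 + Real.log N := by
  have := harmonic_le_one_add_log N
  rw [harmonic] at this
  push_cast at this
  exact this

theorem norm_riemannZeta_le {s : ℂ} (hs : 1 ≤ s.re) (hs1 : s ≠ 1) {N : ℕ} (hN : 1 ≤ N) :
    ‖riemannZeta s‖ ≤ 1 + Real.log N + (2 / ‖s - 1‖ + 2 * ‖s‖ / N) := by
  have h1 := norm_riemannZeta_sub_sum_le hs hs1 hN
  have h2 : ‖∑ m ∈ Finset.range N, ((m + 1 : ℝ) : ℂ) ^ (-s)‖ ≤ 1 + Real.log N := by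
    refine (norm_sum_le_of_le _ fun m _ => ?_).trans (sum_range_inv_le_one_add_log N)
    exact norm_cpow_neg_le_inv hs (by linarith [(m.cast_nonneg : (0 : ℝ) ≤ m)])
  have h3 := norm_le_norm_add_norm_sub (∑ m ∈ Finset.range N, ((m + 1 : ℝ) : ℂ) ^ (-s))
    (riemannZeta s)
  rw [norm_sub_rev] at h3
  linarith

theorem norm_riemannZeta_add_sub_le {s : ℂ} (hs : 1 ≤ s.re) (hs1 : s ≠ 1) {d : ℝ} (hd : 0 < d)
    {N : ℕ} (hN : 1 ≤ N) :
    ‖riemannZeta (s + d) - riemannZeta s‖ ≤ d * Real.log N * (1 + Real.log N) +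
      (2 / ‖s - 1‖ + 2 * ‖s‖ / N) + (2 / ‖s + d - 1‖ + 2 * ‖s + d‖ / N) := by
  have hre : 1 < (s + d).re := by simp; linarith
  have hsd : s + d ≠ 1 := fun h => by rw [h] at hre; norm_num at hre
  have h1 := norm_riemannZeta_sub_sum_le hs hs1 hN
  have h2 := norm_riemannZeta_sub_sum_le hre.le hsd hN
  have h3 : ‖∑ m ∈ Finset.range N, ((m + 1 : ℝ) : ℂ) ^ (-(s + d)) -
      ∑ m ∈ Finset.range N, ((m + 1 : ℝ) : ℂ) ^ (-s)‖ ≤ d * Real.log N * (1 + Real.log N) := by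
    rw [← Finset.sum_sub_distrib]
    refine (norm_sum_le_of_le (f := fun m : ℕ =>
      ((m + 1 : ℝ) : ℂ) ^ (-(s + d)) - ((m + 1 : ℝ) : ℂ) ^ (-s))
      (n := fun m : ℕ => d * Real.log N * ((m : ℝ) + 1)⁻¹) _ fun m hm => ?_).trans ?_
    · have hm0 : (1 : ℝ) ≤ m + 1 := by linarith [(m.cast_nonneg : (0 : ℝ) ≤ m)]
      have hmN : (m + 1 : ℝ) ≤ N := by exact_mod_cast Finset.mem_range.1 hm
      have hne : ((m + 1 : ℝ) : ℂ) ≠ 0 := by exact_mod_cast m.succ_ne_zero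
      have hfac : ((m + 1 : ℝ) : ℂ) ^ (-(s + d)) - ((m + 1 : ℝ) : ℂ) ^ (-s) =
          (((m + 1 : ℝ) ^ (-d) - 1 : ℝ) : ℂ) * ((m + 1 : ℝ) : ℂ) ^ (-s) := by
        rw [neg_add, Complex.cpow_add _ _ hne, Complex.ofReal_sub,
          Complex.ofReal_cpow (by linarith)]
        push_cast
        ring
      rw [hfac, norm_mul]
      refine mul_le_mul ?_ (norm_cpow_neg_le_inv hs hm0) (norm_nonneg _) ?_
      · have hlog : Real.log (m + 1) ≤ Real.log N := Real.log_le_log (by linarith) hmN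
        have hle : (m + 1 : ℝ) ^ (-d) ≤ 1 :=
          Real.rpow_le_one_of_one_le_of_nonpos hm0 (by linarith)
        -- From `exp u ≥ 1 + u`: the shift changes each term by a relative amount at most `d
        -- log(m+1)`.
        have hge : 1 - d * Real.log (m + 1) ≤ (m + 1 : ℝ) ^ (-d) := by
          rw [Real.rpow_def_of_pos (by linarith)]
          have := Real.add_one_le_exp (Real.log (m + 1) * -d)
          linarith
        rw [Complex.norm_real, Real.norm_eq_abs, abs_sub_comm, abs_of_nonneg (by linarith)]
        have := mul_le_mul_of_nonneg_left hlog hd.le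
        linarith
      · exact mul_nonneg hd.le (Real.log_natCast_nonneg N)
    · rw [← Finset.mul_sum]
      exact mul_le_mul_of_nonneg_left (sum_range_inv_le_one_add_log N)
        (mul_nonneg hd.le (Real.log_natCast_nonneg N))
  set A := ∑ m ∈ Finset.range N, ((m + 1 : ℝ) : ℂ) ^ (-(s + d))
  set B := ∑ m ∈ Finset.range N, ((m + 1 : ℝ) : ℂ) ^ (-s)
  have h4 : riemannZeta (s + d) - riemannZeta s =
      (A - B) + (riemannZeta (s + d) - A) - (riemannZeta s - B) := by ring
  rw [h4]
  have := norm_sub_le ((A - B) + (riemannZeta (s + d) - A)) (riemannZeta s - B)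
  have := norm_add_le (A - B) (riemannZeta (s + d) - A)
  linarith

/-! ### Lower bounds for zeta on `Re s = r ≥ 1` -/

theorem one_le_norm_riemannZeta_product {d : ℝ} (hd : 0 < d) (t : ℝ) :
    1 ≤ ‖riemannZeta (1 + d)‖ ^ 3 * ‖riemannZeta (1 + d + Complex.I * t)‖ ^ 4 *
      ‖riemannZeta (1 + d + 2 * Complex.I * t)‖ := by
  have := DirichletCharacter.norm_LFunction_product_ge_one (N := 1) 1 hd t
  simpa [DirichletCharacter.LFunctionTrivChar, DirichletCharacter.LFunction_modOne_eq,
    norm_mul, norm_pow] using this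

/-- Partial sums of length `N = ⌈T²⌉` make the error `|s|/N` of order `1/T`. The constant is `1 +
192`, from `log N ≤ 192 N^{1/192}` and `N ≤ T³`. -/
theorem one_add_log_ceil_sq_le {T : ℝ} (hT : 2 ≤ T) :
    1 + Real.log ⌈T ^ 2⌉₊ ≤ 193 * T ^ (1 / 64 : ℝ) := by
  have h1 : (⌈T ^ 2⌉₊ : ℝ) ≤ T ^ 3 := by
    have := (Nat.ceil_lt_add_one (a := T ^ 2) (by positivity)).le
    nlinarith [mul_nonneg (sq_nonneg T) (by linarith : 0 ≤ T - 2)]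
  have h2 := Real.log_le_rpow_div (x := (⌈T ^ 2⌉₊ : ℝ)) (by positivity)
    (ε := 1 / 192) (by norm_num)
  have h3 : (⌈T ^ 2⌉₊ : ℝ) ^ (1 / 192 : ℝ) ≤ T ^ (1 / 64 : ℝ) := by
    refine (Real.rpow_le_rpow (by positivity) h1 (by norm_num)).trans_eq ?_
    rw [← Real.rpow_natCast, ← Real.rpow_mul (by linarith)]
    norm_num
  have h4 : 1 ≤ T ^ (1 / 64 : ℝ) := Real.one_le_rpow (by linarith) (by norm_num)
  rw [div_eq_mul_inv] at h2
  norm_num at h2 h3 h4 ⊢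
  linarith

theorem le_norm_riemannZeta_one_add_rpow_add {t : ℝ} (ht : 2 ≤ |t|) :
    1 / 17 * |t| ^ (-(1 / 5) : ℝ) ≤
      ‖riemannZeta (1 + (|t| ^ (-(1 / 4) : ℝ) : ℝ) + Complex.I * t)‖ := by
  set T := |t| with hTdef
  have hT0 : 0 < T := by linarith
  set d := T ^ (-(1 / 4) : ℝ) with hd
  have hd0 : 0 < d := Real.rpow_pos_of_pos hT0 _
  have hd1 : d ≤ 1 := Real.rpow_le_one_of_one_le_of_nonpos (by linarith) (by norm_num)
  have hprod := one_le_norm_riemannZeta_product hd0 t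
  have hz1 : ‖riemannZeta (1 + d)‖ ≤ 7 / d := by
    have hne : (1 + d : ℂ) ≠ 1 := by simpa using hd0.ne'
    have h := norm_riemannZeta_le (s := 1 + d) (by simp; linarith) hne (N := 1) le_rfl
    have e1 : ‖(1 + d : ℂ) - 1‖ = d := by simp [abs_of_pos hd0]
    have e2 : ‖(1 + d : ℂ)‖ ≤ 2 := by
      refine (norm_add_le _ _).trans ?_
      simp [abs_of_pos hd0]; linarith
    rw [e1] at h
    have : 1 ≤ 1 / d := by rw [le_div_iff₀ hd0]; linarith
    have e3 : 7 / d = 2 / d + 5 * (1 / d) := by ring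
    rw [e3]
    simp only [Nat.cast_one, Real.log_one, div_one] at h
    linarith
  have hz2 : ‖riemannZeta (1 + d + 2 * Complex.I * t)‖ ≤ 197 * T ^ (1 / 64 : ℝ) := by
    have him : (1 + d + 2 * Complex.I * t : ℂ).im = 2 * t := by simp
    have hre : (1 + d + 2 * Complex.I * t : ℂ).re = 1 + d := by simp
    have hnorm1 : 2 * T ≤ ‖(1 + d + 2 * Complex.I * t : ℂ) - 1‖ := by
      refine le_trans (le_of_eq ?_) (Complex.abs_im_le_norm _)
      rw [Complex.sub_im, him]; simp [abs_mul, hTdef]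
    have hne : (1 + d + 2 * Complex.I * t : ℂ) ≠ 1 := fun h => by
      rw [h] at hnorm1; simp at hnorm1; linarith
    have hnorm2 : ‖(1 + d + 2 * Complex.I * t : ℂ)‖ ≤ 2 + 2 * T := by
      refine (Complex.norm_le_abs_re_add_abs_im _).trans ?_
      rw [him, hre, abs_of_pos (by linarith), abs_mul, ← hTdef]
      norm_num; linarith
    have hN2 : T ^ 2 ≤ (⌈T ^ 2⌉₊ : ℝ) := Nat.le_ceil _
    have hN : 1 ≤ ⌈T ^ 2⌉₊ := Nat.one_le_ceil_iff.2 (by positivity)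
    have h := norm_riemannZeta_le (s := 1 + d + 2 * Complex.I * t) (by rw [hre]; linarith) hne hN
    have hl := one_add_log_ceil_sq_le ht
    have b1 : 2 / ‖(1 + d + 2 * Complex.I * t : ℂ) - 1‖ ≤ 1 / 2 := by
      rw [div_le_div_iff₀ (by linarith) (by norm_num)]; linarith
    have b2 : 2 * ‖(1 + d + 2 * Complex.I * t : ℂ)‖ / (⌈T ^ 2⌉₊ : ℝ) ≤ 3 := by
      rw [div_le_iff₀ (by positivity)]; nlinarith
    have h4 : 1 ≤ T ^ (1 / 64 : ℝ) := Real.one_le_rpow (by linarith) (by norm_num)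
    linarith
  set z := ‖riemannZeta (1 + d + Complex.I * t)‖ with hz
  have hz0 : 0 ≤ z := norm_nonneg _
  have h1 : 1 ≤ (7 / d) ^ 3 * z ^ 4 * (197 * T ^ (1 / 64 : ℝ)) := hprod.trans (by gcongr)
  have hd3 : (1 / d) ^ 3 = T ^ (3 / 4 : ℝ) := by
    rw [hd, one_div, ← Real.rpow_neg hT0.le, ← Real.rpow_natCast, ← Real.rpow_mul hT0.le]
    norm_num
  -- `67571 = 7³ · 197`, below `17⁴`; and `3/4 + 1/64 ≤ 4/5`.
  have h2 : 1 ≤ 67571 * z ^ 4 * T ^ (4 / 5 : ℝ) := by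
    calc 1 ≤ _ := h1
      _ = 67571 * z ^ 4 * ((1 / d) ^ 3 * T ^ (1 / 64 : ℝ)) := by ring
      _ = 67571 * z ^ 4 * T ^ (3 / 4 + 1 / 64 : ℝ) := by rw [hd3, Real.rpow_add hT0]
      _ ≤ _ := by
        gcongr 67571 * z ^ 4 * ?_
        exact Real.rpow_le_rpow_of_exponent_le (by linarith) (by norm_num)
  have h3 : (T ^ (-(1 / 5) : ℝ)) ^ 4 * T ^ (4 / 5 : ℝ) = 1 := by
    rw [← Real.rpow_natCast, ← Real.rpow_mul hT0.le, ← Real.rpow_add hT0]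
    norm_num
  have h4 : 0 < T ^ (4 / 5 : ℝ) := Real.rpow_pos_of_pos hT0 _
  refine le_of_pow_le_pow_left₀ (n := 4) (by norm_num) hz0 ?_
  refine le_of_mul_le_mul_right ?_ h4
  rw [mul_pow, mul_assoc, h3]
  norm_num
  linarith

/-- The main term is `d log² N`, of exponent `-1/4 + 2/64 = -7/32`, which beats the `-1/5` of the
lower bound. -/
theorem norm_riemannZeta_one_add_rpow_sub_le {t : ℝ} (ht : 2 ≤ |t|) :
    ‖riemannZeta (1 + (|t| ^ (-(1 / 4) : ℝ) : ℝ) + Complex.I * t) -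
      riemannZeta (1 + Complex.I * t)‖ ≤ 40000 * |t| ^ (-(7 / 32) : ℝ) := by
  set T := |t| with hTdef
  have hT0 : 0 < T := by linarith
  set d := T ^ (-(1 / 4) : ℝ) with hd
  have hd0 : 0 < d := Real.rpow_pos_of_pos hT0 _
  have hd1 : d ≤ 1 := Real.rpow_le_one_of_one_le_of_nonpos (by linarith) (by norm_num)
  have hnorm (e : ℝ) : T ≤ ‖(1 + Complex.I * t : ℂ) + e - 1‖ := by
    refine le_trans (le_of_eq ?_) (Complex.abs_im_le_norm _)
    simp [hTdef]
  have hnorm2 (e : ℝ) (he : 0 ≤ e) (he1 : e ≤ 1) : ‖(1 + Complex.I * t : ℂ) + e‖ ≤ 2 * T := by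
    refine (Complex.norm_le_abs_re_add_abs_im _).trans ?_
    simp [← hTdef]
    rw [abs_of_nonneg (by linarith)]; linarith
  have b1 := hnorm d
  have b2 := hnorm2 d hd0.le hd1
  have b3 := hnorm 0
  have b4 := hnorm2 0 le_rfl zero_le_one
  rw [Complex.ofReal_zero, add_zero] at b3 b4
  have hne : (1 + Complex.I * t : ℂ) ≠ 1 := fun h => by
    rw [h] at b3; simp at b3; linarith
  have hN2 : T ^ 2 ≤ (⌈T ^ 2⌉₊ : ℝ) := Nat.le_ceil _
  have hN : 1 ≤ ⌈T ^ 2⌉₊ := Nat.one_le_ceil_iff.2 (by positivity)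
  have h := norm_riemannZeta_add_sub_le (s := 1 + Complex.I * t) (by simp) hne hd0 hN
  rw [show (1 + Complex.I * t + d : ℂ) = 1 + d + Complex.I * t by ring] at h b1 b2
  have hl := one_add_log_ceil_sq_le ht
  have frac1 (x : ℝ) (hx : T ≤ x) : 2 / x ≤ 2 / T := by gcongr
  have frac2 (x : ℝ) (hx : x ≤ 2 * T) : 2 * x / (⌈T ^ 2⌉₊ : ℝ) ≤ 4 / T := by
    rw [div_le_div_iff₀ (by positivity) hT0]
    nlinarith
  have hinv : 1 / T ≤ T ^ (-(7 / 32) : ℝ) := by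
    rw [one_div, ← Real.rpow_neg_one]
    exact Real.rpow_le_rpow_of_exponent_le (by linarith) (by norm_num)
  have hmain : d * Real.log ⌈T ^ 2⌉₊ * (1 + Real.log ⌈T ^ 2⌉₊) ≤
      37249 * T ^ (-(7 / 32) : ℝ) := by
    have hl0 : 0 ≤ Real.log ⌈T ^ 2⌉₊ := Real.log_natCast_nonneg _
    calc _ ≤ d * (193 * T ^ (1 / 64 : ℝ)) * (193 * T ^ (1 / 64 : ℝ)) := by
          gcongr
          linarith
      _ = 37249 * (d * T ^ (1 / 64 : ℝ) * T ^ (1 / 64 : ℝ)) := by ring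
      _ = _ := by
        rw [hd, ← Real.rpow_add hT0, ← Real.rpow_add hT0]; norm_num
  have c1 := frac1 _ b1
  have c2 := frac1 _ b3
  have c3 := frac2 _ b2
  have c4 := frac2 _ b4
  have e1 : 2 / T = 2 * (1 / T) := by ring
  have e2 : 4 / T = 4 * (1 / T) := by ring
  rw [e1] at c1 c2
  rw [e2] at c3 c4
  have : 0 < T ^ (-(7 / 32) : ℝ) := Real.rpow_pos_of_pos hT0 _
  linarith

theorem exists_le_norm_riemannZeta_one_add :
    ∃ c > 0, ∃ R ≥ (2 : ℝ), ∀ t : ℝ, R ≤ |t| →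
      c * |t| ^ (-(1 / 5) : ℝ) ≤ ‖riemannZeta (1 + Complex.I * t)‖ := by
  have hlim : Tendsto (fun T : ℝ => T ^ (3 / 160 : ℝ)) atTop atTop :=
    tendsto_rpow_atTop (by norm_num)
  -- `3/160 = 7/32 - 1/5` and `1360000 = 34 · 40000`: beyond `R` the shift costs at most half of the
  -- lower bound `1/17 |t|^{-1/5}`.
  obtain ⟨R, hR⟩ := eventually_atTop.1 (hlim.eventually_ge_atTop 1360000)
  refine ⟨1 / 34, by norm_num, max R 2, le_max_right _ _, fun t ht => ?_⟩
  have ht2 : 2 ≤ |t| := (le_max_right _ _).trans ht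
  have hT0 : 0 < |t| := by linarith
  have hbig := hR |t| ((le_max_left _ _).trans ht)
  have h1 := le_norm_riemannZeta_one_add_rpow_add ht2
  have h2 := norm_riemannZeta_one_add_rpow_sub_le ht2
  have h3 : |t| ^ (-(1 / 5) : ℝ) = |t| ^ (3 / 160 : ℝ) * |t| ^ (-(7 / 32) : ℝ) := by
    rw [← Real.rpow_add hT0]; norm_num
  have h4 : 0 < |t| ^ (-(7 / 32) : ℝ) := Real.rpow_pos_of_pos hT0 _
  have h5 := mul_le_mul_of_nonneg_right hbig h4.le
  rw [← h3] at h5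
  have h6 := norm_le_norm_add_norm_sub (riemannZeta (1 + Complex.I * t))
    (riemannZeta (1 + (|t| ^ (-(1 / 4) : ℝ) : ℝ) + Complex.I * t))
  rw [norm_sub_rev] at h6
  linarith

/-- `1/ζ` is the Dirichlet series of the Möbius function, bounded on the line by its absolute sum at
`r`. -/
theorem exists_le_norm_riemannZeta_of_one_lt {r : ℝ} (hr : 1 < r) :
    ∃ c > 0, ∀ s : ℂ, s.re = r → c ≤ ‖riemannZeta s‖ := by
  have hsum : Summable fun k => ‖LSeries.term (fun k => (ArithmeticFunction.moebius k : ℂ)) r k‖ :=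
    (ArithmeticFunction.LSeriesSummable_moebius_iff.2 (by simpa using hr)).norm
  set C := ∑' k, ‖LSeries.term (fun k => (ArithmeticFunction.moebius k : ℂ)) r k‖ with hC
  have hC0 : 0 ≤ C := tsum_nonneg fun _ => norm_nonneg _
  refine ⟨1 / (C + 1), by positivity, fun s hs => ?_⟩
  have hs1 : 1 < s.re := by rw [hs]; exact hr
  have hprod := ArithmeticFunction.LSeries_zeta_mul_Lseries_moebius hs1
  rw [ArithmeticFunction.LSeries_zeta_eq_riemannZeta hs1] at hprod
  have hL : ‖LSeries (fun k => (ArithmeticFunction.moebius k : ℂ)) s‖ ≤ C :=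
    tsum_of_norm_bounded hsum.hasSum fun k =>
      LSeries.norm_term_le_of_re_le_re _ (by simp [hs]) k
  have h1 := congrArg norm hprod
  rw [norm_mul, norm_one] at h1
  rw [div_le_iff₀ (by positivity), ← h1]
  gcongr
  linarith

theorem exists_le_norm_riemannZeta {r : ℝ} (hr : 1 ≤ r) :
    ∃ c > 0, ∃ R ≥ (2 : ℝ), ∀ s : ℂ, s.re = r → R ≤ |s.im| →
      c * |s.im| ^ (-(1 / 5) : ℝ) ≤ ‖riemannZeta s‖ := by
  rcases hr.eq_or_lt with rfl | hr
  · obtain ⟨c, hc, R, hR, h⟩ := exists_le_norm_riemannZeta_one_add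
    refine ⟨c, hc, R, hR, fun s hs him => ?_⟩
    have := h s.im him
    rwa [show (1 + Complex.I * s.im : ℂ) = s by apply Complex.ext <;> simp [hs]] at this
  · obtain ⟨c, hc, h⟩ := exists_le_norm_riemannZeta_of_one_lt hr
    refine ⟨c, hc, 2, le_rfl, fun s hs him => (mul_le_of_le_one_right hc.le ?_).trans (h s hs)⟩
    exact Real.rpow_le_one_of_one_le_of_nonpos (by linarith) (by norm_num)

/-! ### Nonvanishing and growth of `n`, decay of `f` -/

theorem xi_one : xi 1 = 1 / 2 := by
  rw [xi_eq]; simp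

theorem two_mul_xi_eq {s : ℂ} (hs : 0 < s.re) (h1 : s ≠ 1) :
    2 * xi s = l s * (s - 1) * riemannZeta s := by
  rw [xi_eq_half_a_mul_zeta h1, a]
  · ring
  · intro k hk
    rw [hk] at hs
    simp at hs
    have : (0 : ℝ) ≤ k := k.cast_nonneg
    linarith

theorem l_ne_zero {s : ℂ} (hs : 0 < s.re) : l s ≠ 0 := by
  refine mul_ne_zero ?_ (mul_ne_zero two_ne_zero (Complex.Gamma_ne_zero_of_re_pos ?_))
  · rw [Complex.cpow_ne_zero_iff]
    exact Or.inl (by exact_mod_cast Real.pi_ne_zero)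
  · simp; linarith

theorem xi_ne_zero {s : ℂ} (hs : 1 ≤ s.re) : xi s ≠ 0 := by
  by_cases h1 : s = 1
  · rw [h1, xi_one]; norm_num
  · have h0 : 0 < s.re := by linarith
    have := mul_ne_zero (mul_ne_zero (l_ne_zero h0) (sub_ne_zero.2 h1))
      (riemannZeta_ne_zero_of_one_le_re hs)
    rw [← two_mul_xi_eq h0 h1] at this
    exact right_ne_zero_of_mul this

theorem n_ne_zero {s : ℂ} (hs : 1 / 2 ≤ s.re) (h4 : ∀ w : ℤ, 1 ≤ w → s ≠ 4 * w) : n s ≠ 0 := by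
  refine mul_ne_zero (fun h => ?_) (mul_ne_zero two_ne_zero (xi_ne_zero ?_))
  · obtain ⟨k, hk⟩ := Complex.sin_eq_zero_iff.1 h
    have hpi : (Real.pi : ℂ) ≠ 0 := by exact_mod_cast Real.pi_ne_zero
    have hsk : s = 4 * k := mul_left_cancel₀ hpi (by linear_combination 4 * hk)
    refine h4 k ?_ hsk
    rw [hsk] at hs
    simp at hs
    have : (0 : ℝ) < k := by linarith
    exact_mod_cast this
  · simp; linarith

theorem n_differentiable : Differentiable ℂ n := by
  have := xi_differentiable
  unfold n
  fun_prop

theorem le_norm_l {s : ℂ} (hs : 1 ≤ s.re) (him : 2 ≤ |s.im|) :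
    Real.pi ^ (-s.re / 2) * (1 / 4 * |s.im| * Real.exp (-(Real.pi / 4 * |s.im|))) ≤ ‖l s‖ := by
  have him2 : |(1 + s / 2).im| = |s.im| / 2 := by simp [abs_div]
  have hG := le_norm_Gamma (s := 1 + s / 2) (by simp; linarith) (by rw [him2]; linarith)
  rw [him2] at hG
  rw [l, norm_mul, Complex.norm_cpow_eq_rpow_re_of_pos Real.pi_pos, norm_mul,
    show (-s / 2).re = -s.re / 2 by simp]
  refine mul_le_mul_of_nonneg_left ?_ (by positivity)
  rw [show Real.pi / 2 * (|s.im| / 2) = Real.pi / 4 * |s.im| by ring] at hG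
  rw [Complex.norm_ofNat]
  linarith

theorem le_norm_sin_pi_mul_div_four {s : ℂ} (him : 2 ≤ |s.im|) :
    1 / 4 * Real.exp (Real.pi / 4 * |s.im|) ≤ ‖Complex.sin (Real.pi * s / 4)‖ := by
  have h := norm_sin_ge (Real.pi * s / 4)
  have h1 : |((Real.pi : ℂ) * s / 4).im| = Real.pi / 4 * |s.im| := by
    simp [abs_mul, abs_div, abs_of_pos Real.pi_pos]; ring
  rw [h1] at h
  have h2 := Real.add_one_le_exp (Real.pi / 4 * |s.im|)
  -- This gives `exp ≥ 2`, so subtracting `1` at most halves the exponential.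
  have h3 : 1 ≤ Real.pi / 4 * |s.im| := by nlinarith [Real.pi_gt_three]
  linarith

theorem exists_le_norm_n {x : ℝ} (hx : 1 / 2 ≤ x) :
    ∃ c > 0, ∃ R ≥ (2 : ℝ), ∀ s : ℂ, s.re = x → R ≤ |s.im| →
      c * |s.im| ^ (9 / 5 : ℝ) ≤ ‖n s‖ := by
  obtain ⟨c, hc, R, hR, h⟩ := exists_le_norm_riemannZeta (r := 1 / 2 + x) (by linarith)
  have hP : 0 < Real.pi ^ (-(1 / 2 + x) / 2) := Real.rpow_pos_of_pos Real.pi_pos _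
  refine ⟨1 / 16 * Real.pi ^ (-(1 / 2 + x) / 2) * c, by positivity, R, hR, fun s hs him => ?_⟩
  have him2 : 2 ≤ |s.im| := hR.trans him
  have hT : 0 < |s.im| := by linarith
  have hre : (1 / 2 + s).re = 1 / 2 + x := by simp [hs]
  have him' : (1 / 2 + s).im = s.im := by simp
  have hne : 1 / 2 + s ≠ 1 := fun h1 => by
    rw [h1] at him'; simp at him'; simp [← him'] at hT
  have hz := h (1 / 2 + s) hre (by rwa [him'])
  have hl := le_norm_l (s := 1 / 2 + s) (by rw [hre]; linarith) (by rwa [him'])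
  have hw : |s.im| ≤ ‖1 / 2 + s - 1‖ := by
    refine le_trans (le_of_eq ?_) (Complex.abs_im_le_norm _)
    simp
  have hsin := le_norm_sin_pi_mul_div_four him2
  rw [him', hre] at hl
  rw [him'] at hz
  rw [n, two_mul_xi_eq (by rw [hre]; linarith) hne, norm_mul, norm_mul, norm_mul]
  have hE : Real.exp (Real.pi / 4 * |s.im|) * Real.exp (-(Real.pi / 4 * |s.im|)) = 1 := by
    rw [← Real.exp_add, add_neg_cancel, Real.exp_zero]
  have hpow : |s.im| ^ (9 / 5 : ℝ) = |s.im| * |s.im| * |s.im| ^ (-(1 / 5) : ℝ) := by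
    rw [show (9 / 5 : ℝ) = 1 + 1 + -(1 / 5) by norm_num, Real.rpow_add hT, Real.rpow_add hT,
      Real.rpow_one]
  calc _ = 1 / 4 * (Real.exp (Real.pi / 4 * |s.im|) * Real.exp (-(Real.pi / 4 * |s.im|))) *
          (Real.pi ^ (-(1 / 2 + x) / 2) * (1 / 4 * |s.im|) * |s.im| *
            (c * |s.im| ^ (-(1 / 5) : ℝ))) := by
        rw [hE, hpow]; ring
    _ = 1 / 4 * Real.exp (Real.pi / 4 * |s.im|) *
          (Real.pi ^ (-(1 / 2 + x) / 2) * (1 / 4 * |s.im| * Real.exp (-(Real.pi / 4 * |s.im|))) *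
            |s.im| * (c * |s.im| ^ (-(1 / 5) : ℝ))) := by ring
    _ ≤ _ := by gcongr

theorem f_isBigO_cocompact {x : ℝ} (hx : 1 / 2 ≤ x) :
    (fun t : ℝ => ‖f (x + t * Complex.I)‖) =O[cocompact ℝ]
      fun t : ℝ => (1 + ‖t‖) ^ (-(9 / 5) : ℝ) := by
  obtain ⟨c, hc, R, hR, h⟩ := exists_le_norm_n hx
  refine Asymptotics.IsBigO.of_bound (c⁻¹ * 2 ^ (9 / 5 : ℝ)) ?_
  filter_upwards [(tendsto_norm_cocompact_atTop (E := ℝ)).eventually_ge_atTop R] with t ht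
  have ht1 : 1 ≤ ‖t‖ := by linarith
  have him : (x + t * Complex.I : ℂ).im = t := by simp
  have hb := h (x + t * Complex.I) (by simp) (by rwa [him])
  rw [him, ← Real.norm_eq_abs] at hb
  have hle : ((1 + ‖t‖) / 2) ^ (9 / 5 : ℝ) ≤ ‖t‖ ^ (9 / 5 : ℝ) := by
    gcongr
    linarith
  rw [Real.div_rpow (by positivity) (by norm_num)] at hle
  have hp : 0 < (1 + ‖t‖) ^ (9 / 5 : ℝ) := by positivity
  rw [norm_norm, f, norm_div, norm_one, Real.norm_of_nonneg (by positivity),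
    Real.rpow_neg (by positivity)]
  calc 1 / ‖n (x + t * Complex.I)‖ ≤ 1 / (c * ((1 + ‖t‖) ^ (9 / 5 : ℝ) / 2 ^ (9 / 5 : ℝ))) := by
        gcongr
        exact le_trans (by gcongr) hb
    _ = _ := by field_simp

end CsizmaziaZeta

theorem theorem3p1 (x : ℝ) (hx : 1 / 2 ≤ x) (hx4 : ∀ w : ℤ, 1 ≤ w → x ≠ 4 * (w : ℝ)) :
    MeasureTheory.Integrable
        (fun t : ℝ => ‖CsizmaziaZeta.f ((x : ℂ) + (t : ℂ) * Complex.I)‖) MeasureTheory.volume ∧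
      MeasureTheory.Integrable
        (fun t : ℝ => ‖CsizmaziaZeta.f ((x : ℂ) + (t : ℂ) * Complex.I)‖ ^ 2)
        MeasureTheory.volume := by
  have hcont : Continuous fun t : ℝ => ‖CsizmaziaZeta.f ((x : ℂ) + (t : ℂ) * Complex.I)‖ := by
    have hn : Continuous fun t : ℝ => CsizmaziaZeta.n ((x : ℂ) + (t : ℂ) * Complex.I) :=
      CsizmaziaZeta.n_differentiable.continuous.comp (by fun_prop)
    refine (continuous_const.div hn fun t => ?_).norm
    refine CsizmaziaZeta.n_ne_zero (by simpa using hx) fun w hw h => hx4 w hw ?_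
    simpa using congrArg Complex.re h
  have hO := CsizmaziaZeta.f_isBigO_cocompact hx
  have hg : MeasureTheory.Integrable (fun t : ℝ => (1 + ‖t‖) ^ (-(9 / 5) : ℝ)) :=
    integrable_one_add_norm (by norm_num)
  have hone : (fun t : ℝ => (1 + ‖t‖) ^ (-(9 / 5) : ℝ)) =O[Filter.cocompact ℝ]
      fun _ => (1 : ℝ) := by
    refine Asymptotics.IsBigO.of_bound 1 (Filter.Eventually.of_forall fun t => ?_)
    rw [Real.norm_of_nonneg (by positivity), norm_one, one_mul]
    exact Real.rpow_le_one_of_one_le_of_nonpos (by linarith [norm_nonneg t]) (by norm_num)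
  refine ⟨hcont.locallyIntegrable.integrable_of_isBigO_cocompact hO (hg.integrableAtFilter _),
    MeasureTheory.LocallyIntegrable.integrable_of_isBigO_cocompact
      (hcont.pow 2).locallyIntegrable ?_ (hg.integrableAtFilter _)⟩
  -- One factor of the square is estimated only by `O(1)`, so the same majorant serves for `|f|²`.
  simpa only [Pi.pow_def, pow_two, mul_one] using hO.mul (hO.trans hone)
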